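/- Let $d\ge 1$ and $D=\{1,\dots,d\}$. For $x\in[0,1]$ put $\Phi_1(x)=\sqrt3\,(x^2-x)$, $\Phi_2(x)=\sqrt5\,(2x^3-3x^2+x)$ and $\varphi_k=\Phi_k'$ for $k=1,2$. Let $\Lambda=(\lambda^{(k)}_M)$ be a real vector indexed by the pairs $(k,M)$ with $k\in\{1,2\}$, $M\subseteq D$, $2\le|M|\le d$, such that $$c(u_1,\dots,u_d)=1+\sum_{k=1}^{2}\sum_{j=2}^{d}\ \sum_{M\subseteq D,\,|M|=j}\lambda^{(k)}_M\prod_{m\in M}\varphi_k(u_m)$$ is nonnegative on $[0,1]^d$ (this is the case, in particular, whenever $\sum_{j=2}^{d}\sum_{|M|=j}\big(\sqrt3^{\,j}|\lambda^{(1)}_M|+\sqrt5^{\,j}|\lambda^{(2)}_M|\big)\le 1$). Then $c$ is the density of a copula, the $d$-variate extended FGM copula. Let $(U_{i1},\dots,U_{id})$, $i=1,2,\dots$, be i.i.d. random vectors whose common distribution on $[0,1]^d$ has density $c$, and for $n\ge1$ define $$\hat\lambda^{(k)}_M=\frac1n\sum_{i=1}^n\prod_{m\in M}\varphi_k(U_{im}),$$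 and let $\hat\Lambda$ be the vector of all $\hat\lambda^{(k)}_M$. Then: 1. for all $k$ and $M$, the estimator $\hat\lambda^{(k)}_M$ is unbiased: $\mathbb E[\hat\lambda^{(k)}_M]=\lambda^{(k)}_M$ for every $n\ge 1$; 2. for all $k$ and $M$, it is consistent: $\hat\lambda^{(k)}_M\to\lambda^{(k)}_M$ in probability as $n\to\infty$; 3. $\sqrt n\,(\hat\Lambda-\Lambda)\Rightarrow N(\mathbf 0,\Sigma)$ as $n\to\infty$, where the positive semidefinite matrix $\Sigma$ has, for $z,r\in\{1,2\}$ and $P,Q\subseteq D$ with $|P|,|Q|\ge2$, the entries $$\Sigma^{z,r}_{P,Q}=E^{z,r}_{P,Q}-\lambda^{(z)}_P\lambda^{(r)}_Q,\qquad E^{z,r}_{P,Q}=\mathbb E\Big[\prod_{s\in P}\varphi_z(U_{1s})\prod_{t\in Q}\varphi_r(U_{1t})\Big].$$ -/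

import Mathlib

open MeasureTheory ProbabilityTheory Filter Topology

noncomputable section

namespace ExtendedFGM

/-- The integrated shifted Legendre polynomials `Φ₁(x) = √3 (x² - x)` and
`Φ₂(x) = √5 (2x³ - 3x² + x)`. The index `k ∈ {1, 2}` is represented by `Fin 2`, with `0` standing
for `k = 1` and `1` standing for `k = 2`. -/
def Phi (k : Fin 2) (x : ℝ) : ℝ :=
  if k = 0 then √3 * (x ^ 2 - x) else √5 * (2 * x ^ 3 - 3 * x ^ 2 + x)

/-- `φ_k` is the derivative of `Φ_k`. -/
def phi (k : Fin 2) (x : ℝ) : ℝ := deriv (Phi k) x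

/-- The index set of the parameters: pairs `(k, M)` with `k ∈ {1, 2}` and `M ⊆ {1, …, d}`,
`2 ≤ |M| ≤ d`. -/
abbrev ParamIndex (d : ℕ) : Type := Fin 2 × {M : Finset (Fin d) // 2 ≤ M.card}

/-- The random variable / function `∏_{m ∈ M} φ_k(u_m)` attached to the index `(k, M)`. -/
def basisFn {d : ℕ} (p : ParamIndex d) (u : Fin d → ℝ) : ℝ :=
  ∏ m ∈ p.2.1, phi p.1 (u m)

/-- The function `c(u) = 1 + ∑_k ∑_{|M| ≥ 2} λ^{(k)}_M ∏_{m ∈ M} φ_k(u_m)`. -/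
def density {d : ℕ} (lam : EuclideanSpace ℝ (ParamIndex d)) (u : Fin d → ℝ) : ℝ :=
  1 + ∑ p : ParamIndex d, lam p * basisFn p u

/-- `c` is a probability density on the unit cube: it is nonnegative there (its integral over the
cube is automatically `1`). -/
def IsAdmissible {d : ℕ} (lam : EuclideanSpace ℝ (ParamIndex d)) : Prop :=
  ∀ u ∈ Set.Icc (0 : Fin d → ℝ) 1, 0 ≤ density lam u

/-- The `d`-variate extended FGM copula, as a measure: density `c` with respect to Lebesgue measure
on the cube `[0,1]^d`. -/
def copula {d : ℕ} (lam : EuclideanSpace ℝ (ParamIndex d)) : Measure (Fin d → ℝ) :=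
  (volume.restrict (Set.Icc (0 : Fin d → ℝ) 1)).withDensity
    (fun u => ENNReal.ofReal (density lam u))

/-- The estimator `Λ̂` based on the first `n` observations, with entries
`(1/n) ∑_{i ≤ n} ∏_{m ∈ M} φ_k(U_{im})`. -/
def estimator {d : ℕ} {Ω : Type*} (U : ℕ → Ω → Fin d → ℝ) (n : ℕ) (ω : Ω) :
    EuclideanSpace ℝ (ParamIndex d) :=
  WithLp.toLp 2 fun p => (1 / (n : ℝ)) * ∑ i ∈ Finset.range n, basisFn p (U i ω)

/-- `E^{z,r}_{P,Q}`: the expectation, under the copula, of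
`∏_{s ∈ P} φ_z(U_s) ∏_{t ∈ Q} φ_r(U_t)`; here `p = (z, P)` and `q = (r, Q)`. -/
def crossMoment {d : ℕ} (lam : EuclideanSpace ℝ (ParamIndex d)) (p q : ParamIndex d) : ℝ :=
  ∫ u, (∏ s ∈ p.2.1, phi p.1 (u s)) * (∏ t ∈ q.2.1, phi q.1 (u t)) ∂(copula lam)

/-- The matrix `Σ` with entries `Σ^{z,r}_{P,Q} = E^{z,r}_{P,Q} - λ^{(z)}_P λ^{(r)}_Q`. -/
def asympCov {d : ℕ} (lam : EuclideanSpace ℝ (ParamIndex d)) :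
    Matrix (ParamIndex d) (ParamIndex d) ℝ :=
  Matrix.of fun p q => crossMoment lam p q - lam p * lam q

theorem phi_zero (x : ℝ) : phi 0 x = √3 * (2 * x - 1) := by
  have h : HasDerivAt (fun y : ℝ => √3 * (y ^ 2 - y)) (√3 * (2 * x - 1)) x := by
    simpa using ((hasDerivAt_pow 2 x).sub (hasDerivAt_id x)).const_mul (√3)
  have e : Phi 0 = fun y : ℝ => √3 * (y ^ 2 - y) := by
    funext y; simp [Phi]
  rw [phi, e]; exact h.deriv

theorem phi_one (x : ℝ) : phi 1 x = √5 * (6 * x ^ 2 - 6 * x + 1) := by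
  have h : HasDerivAt (fun y : ℝ => √5 * (2 * y ^ 3 - 3 * y ^ 2 + y))
      (√5 * (6 * x ^ 2 - 6 * x + 1)) x := by
    have h' := ((((hasDerivAt_pow 3 x).const_mul 2).sub
      ((hasDerivAt_pow 2 x).const_mul 3)).add (hasDerivAt_id x)).const_mul (√5)
    refine h'.congr_deriv ?_
    norm_num
    ring
  have e : Phi 1 = fun y : ℝ => √5 * (2 * y ^ 3 - 3 * y ^ 2 + y) := by
    funext y; simp [Phi]
  rw [phi, e]; exact h.deriv

/-- The usual explicit restriction on the parameters,
`∑_M (√3^{|M|} |λ^{(1)}_M| + √5^{|M|} |λ^{(2)}_M|) ≤ 1`, makes them admissible. -/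
theorem isAdmissible_of_sum_le_one {d : ℕ} (lam : EuclideanSpace ℝ (ParamIndex d))
    (h : ∑ p : ParamIndex d, (if p.1 = 0 then √3 else √5) ^ p.2.1.card * |lam p| ≤ 1) :
    IsAdmissible lam := by
  intro u hu
  have hphi : ∀ (k : Fin 2) (m : Fin d), |phi k (u m)| ≤ if k = 0 then √3 else √5 := by
    intro k m
    have h0 : 0 ≤ u m := hu.1 m
    have h1 : u m ≤ 1 := hu.2 m
    fin_cases k
    · simp only [Fin.zero_eta, phi_zero, abs_mul, abs_of_nonneg (Real.sqrt_nonneg _), if_true]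
      refine mul_le_of_le_one_right (Real.sqrt_nonneg _) (abs_le.2 ⟨?_, ?_⟩) <;> linarith
    · simp only [Fin.mk_one, phi_one, abs_mul, abs_of_nonneg (Real.sqrt_nonneg _)]
      refine mul_le_of_le_one_right (Real.sqrt_nonneg _) (abs_le.2 ⟨?_, ?_⟩) <;>
        nlinarith [sq_nonneg (2 * u m - 1), mul_nonneg h0 (sub_nonneg.2 h1)]
  have hb : ∀ p : ParamIndex d,
      |lam p * basisFn p u| ≤ (if p.1 = 0 then √3 else √5) ^ p.2.1.card * |lam p| := by
    intro p
    rw [abs_mul, mul_comm]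
    refine mul_le_mul_of_nonneg_right ?_ (abs_nonneg _)
    rw [basisFn, Finset.abs_prod, ← Finset.prod_const]
    exact Finset.prod_le_prod (fun m _ => abs_nonneg _) fun m _ => hphi p.1 m
  have hs := (Finset.abs_sum_le_sum_abs (fun p => lam p * basisFn p u) Finset.univ).trans
    ((Finset.sum_le_sum fun p _ => hb p).trans h)
  have := (abs_le.1 hs).1
  rw [density]
  linarith

end ExtendedFGM

end

namespace ExtendedFGM

open scoped RealInnerProductSpace Matrix

/-! ### Multivariate central limit theorem via characteristic functions. -/

section CentralLimit

variable {Ω ι : Type*} [MeasurableSpace Ω] {P : Measure Ω} [Fintype ι]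

/-! Together with the constant 1, `phi 0` and `phi 1` are orthonormal in L²[0,1]. By Fubini, the
products `basisFn p` are orthonormal and centred on the cube, so integrating `basisFn p` against
`density lam` returns `lam p` (`integral_basisFn_copula`). The estimator is therefore the sample
mean of the i.i.d. vectors `basisVec (U i)`, which are a.s. bounded, have mean `lam` and covariance
`asympCov lam`. Linearity gives unbiasedness, the strong law gives consistency, and
`tendstoInDistribution_multivariate`, reduced to dimension one by the Cramér–Wold device, gives
normality. -/

lemma dotProduct_mulVec_covariance [IsFiniteMeasure P] {Y : ι → Ω → ℝ}
    (hY : ∀ i, MemLp (Y i) 2 P) (x : ι → ℝ) :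
    x ⬝ᵥ (Matrix.of fun i j => cov[Y i, Y j; P]) *ᵥ x = Var[fun ω => ∑ i, x i * Y i ω; P] := by
  rw [variance_fun_sum fun i => (hY i).const_mul (x i)]
  simp only [dotProduct, Matrix.mulVec, Matrix.of_apply, Finset.mul_sum, covariance_const_mul_left,
    covariance_const_mul_right]
  exact Finset.sum_congr rfl fun i _ => Finset.sum_congr rfl fun j _ => by ring

lemma posSemidef_covariance [IsFiniteMeasure P] {Y : ι → Ω → ℝ} (hY : ∀ i, MemLp (Y i) 2 P) :
    (Matrix.of fun i j => cov[Y i, Y j; P]).PosSemidef := by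
  refine Matrix.PosSemidef.of_dotProduct_mulVec_nonneg ?_ fun x => ?_
  · ext i j
    simp [covariance_comm]
  · rw [star_trivial, dotProduct_mulVec_covariance hY]
    exact variance_nonneg _ _

/-- The Cramér–Wold reduction: it lets the one-dimensional limit theorem act on each projection. -/
lemma charFun_map_eq_charFun_map_inner {E : Type*} [NormedAddCommGroup E] [InnerProductSpace ℝ E]
    [MeasurableSpace E] [BorelSpace E] {Z : Ω → E} (hZ : AEMeasurable Z P) (t : E) :
    charFun (P.map Z) t = charFun (P.map fun ω => ⟪t, Z ω⟫) 1 := by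
  have hm : AEMeasurable (fun ω => ⟪t, Z ω⟫) P :=
    (innerSL ℝ t).continuous.measurable.comp_aemeasurable hZ
  rw [charFun_apply, charFun_apply, integral_map hZ, integral_map hm]
  · simp [real_inner_comm]
  · exact Continuous.aestronglyMeasurable (by fun_prop)
  · have ht : Continuous fun x : E => ⟪x, t⟫ := continuous_id.inner continuous_const
    exact (by fun_prop : Continuous fun x : E =>
      Complex.exp ((⟪x, t⟫ : ℝ) * Complex.I)).measurable.aestronglyMeasurable

/-- The multivariate central limit theorem for i.i.d. square integrable random vectors. -/
theorem tendstoInDistribution_multivariate [DecidableEq ι] [IsProbabilityMeasure P]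
    {X : ℕ → Ω → EuclideanSpace ℝ ι}
    (hX : MemLp (X 0) 2 P) (hindep : iIndepFun X P)
    (hident : ∀ i, IdentDistrib (X i) (X 0) P P) :
    TendstoInDistribution
      (fun (n : ℕ) ω => (√(n : ℝ))⁻¹ • (∑ k ∈ Finset.range n, X k ω - (n : ℝ) • P[X 0])) atTop id
      (fun _ => P)
      (multivariateGaussian 0 (Matrix.of fun i j =>
        cov[fun ω => X 0 ω i, fun ω => X 0 ω j; P])) := by
  have hm : ∀ n, AEMeasurable (X n) P := fun n => (hident n).aemeasurable_fst
  have hmS : ∀ n : ℕ, AEMeasurable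
      (fun ω => (√(n : ℝ))⁻¹ • (∑ k ∈ Finset.range n, X k ω - (n : ℝ) • P[X 0])) P := by
    intro n
    have := Finset.aemeasurable_fun_sum (Finset.range n) fun k _ => hm k
    fun_prop
  have hXi : ∀ i, MemLp (fun ω => X 0 ω i) 2 P := fun i =>
    (EuclideanSpace.proj (𝕜 := ℝ) i).comp_memLp' hX
  refine ⟨hmS, by fun_prop, ProbabilityMeasure.tendsto_iff_tendsto_charFun.2 fun t => ?_⟩
  -- Scalar central limit theorem for the projections on `t`, then read off at frequency 1.
  have hlim := (tendstoInDistribution_inv_sqrt_mul_sum_sub (X := fun k ω => ⟪t, X k ω⟫)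
    (Y := id) (P' := gaussianReal 0 Var[fun ω => ⟪t, X 0 ω⟫; P].toNNReal) (P := P) HasLaw.id
    ((innerSL ℝ t).comp_memLp' hX)
    (hindep.comp (fun _ x => ⟪t, x⟫) fun _ => (innerSL ℝ t).continuous.measurable)
    (fun i => (hident i).comp (innerSL ℝ t).continuous.measurable)).tendsto
  have hlim1 := ProbabilityMeasure.tendsto_iff_tendsto_charFun.1 hlim 1
  simp only [ProbabilityMeasure.coe_mk, Measure.map_id] at hlim1 ⊢
  have hvar : t ⬝ᵥ (Matrix.of fun i j => cov[fun ω => X 0 ω i, fun ω => X 0 ω j; P]) *ᵥ t =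
      Var[fun ω => ⟪t, X 0 ω⟫; P] := by
    rw [dotProduct_mulVec_covariance hXi]
    simp [PiLp.inner_apply, mul_comm]
  rw [charFun_multivariateGaussian (posSemidef_covariance hXi), hvar]
  rw [charFun_gaussianReal] at hlim1
  convert hlim1 using 2 with n
  · rw [charFun_map_eq_charFun_map_inner (hmS n)]
    have hint : ∫ ω, ⟪t, X 0 ω⟫ ∂P = ⟪t, ∫ ω, X 0 ω ∂P⟫ :=
      (innerSL ℝ t).integral_comp_comm (hX.integrable (by norm_num))
    simp only [inner_smul_right, inner_sub_right, inner_sum, hint]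
  · congr 1
    simp [Real.coe_toNNReal _ (variance_nonneg _ _)]

end CentralLimit

/-! ### Orthonormality of the product basis and moments of the copula. -/

section Orthonormality

variable {d : ℕ}

lemma continuous_phi (k : Fin 2) : Continuous (phi k) := by
  fin_cases k
  · simp only [Fin.zero_eta, funext phi_zero]
    fun_prop
  · simp only [Fin.mk_one, funext phi_one]
    fun_prop

lemma continuous_basisFn (p : ParamIndex d) : Continuous (basisFn p) :=
  continuous_finsetProd _ fun m _ => (continuous_phi p.1).comp (continuous_apply m)

lemma continuous_density (lam : EuclideanSpace ℝ (ParamIndex d)) : Continuous (density lam) := by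
  unfold density
  have := continuous_basisFn (d := d)
  fun_prop

/-- The primitive `Phi k` vanishes at both 0 and 1. -/
lemma integral_phi (k : Fin 2) : ∫ x in Set.Icc (0 : ℝ) 1, phi k x = 0 := by
  rw [integral_Icc_eq_integral_Ioc, ← intervalIntegral.integral_of_le zero_le_one]
  have h : ∀ x, HasDerivAt (Phi k) (phi k x) x := fun x => by
    refine DifferentiableAt.hasDerivAt ?_
    unfold Phi
    split_ifs <;> fun_prop
  rw [intervalIntegral.integral_eq_sub_of_hasDerivAt (fun x _ => h x)
    ((continuous_phi k).intervalIntegrable _ _)]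
  fin_cases k <;> norm_num [Phi]

lemma integral_phi_mul_phi (k l : Fin 2) :
    ∫ x in Set.Icc (0 : ℝ) 1, phi k x * phi l x = if k = l then 1 else 0 := by
  rw [integral_Icc_eq_integral_Ioc, ← intervalIntegral.integral_of_le zero_le_one]
  have key : ∀ F : ℝ → ℝ, (∀ x, HasDerivAt F (phi k x * phi l x) x) →
      ∫ x in (0 : ℝ)..1, phi k x * phi l x = F 1 - F 0 := fun F hF =>
    intervalIntegral.integral_eq_sub_of_hasDerivAt (fun x _ => hF x)
      (((continuous_phi k).mul (continuous_phi l)).intervalIntegrable _ _)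
  -- The products have degree at most 4; the coefficients supplied below are those of their
  -- primitives vanishing at 0.
  have hpow : ∀ a₁ a₂ a₃ a₄ a₅ x : ℝ,
      HasDerivAt (fun x => a₁ * x + a₂ * x ^ 2 + a₃ * x ^ 3 + a₄ * x ^ 4 + a₅ * x ^ 5)
        (a₁ + 2 * a₂ * x + 3 * a₃ * x ^ 2 + 4 * a₄ * x ^ 3 + 5 * a₅ * x ^ 4) x := by
    intro a₁ a₂ a₃ a₄ a₅ x
    refine ((((((hasDerivAt_id x).const_mul a₁).add ((hasDerivAt_pow 2 x).const_mul a₂)).add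
      ((hasDerivAt_pow 3 x).const_mul a₃)).add ((hasDerivAt_pow 4 x).const_mul a₄)).add
      ((hasDerivAt_pow 5 x).const_mul a₅)).congr_deriv ?_
    norm_num
    ring
  have h3 : √3 * √3 = (3 : ℝ) := Real.mul_self_sqrt (by norm_num)
  have h5 : √5 * √5 = (5 : ℝ) := Real.mul_self_sqrt (by norm_num)
  fin_cases k <;> fin_cases l
  · refine (key _ fun x => (hpow 3 (-6) 4 0 0 x).congr_deriv ?_).trans (by norm_num)
    simp only [Fin.zero_eta, phi_zero]
    linear_combination -(2 * x - 1) ^ 2 * h3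
  · refine (key _ fun x => (hpow (-(√3 * √5)) (4 * (√3 * √5)) (-6 * (√3 * √5)) (3 * (√3 * √5)) 0
      x).congr_deriv ?_).trans (by norm_num; ring)
    simp only [Fin.zero_eta, Fin.mk_one, phi_zero, phi_one]
    ring
  · refine (key _ fun x => (hpow (-(√3 * √5)) (4 * (√3 * √5)) (-6 * (√3 * √5)) (3 * (√3 * √5)) 0
      x).congr_deriv ?_).trans (by norm_num; ring)
    simp only [Fin.zero_eta, Fin.mk_one, phi_zero, phi_one]
    ring
  · refine (key _ fun x => (hpow 5 (-30) 80 (-90) 36 x).congr_deriv ?_).trans (by norm_num)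
    simp only [Fin.mk_one, phi_one]
    linear_combination -(6 * x ^ 2 - 6 * x + 1) ^ 2 * h5

lemma volume_restrict_Icc_eq_pi :
    (volume : Measure (Fin d → ℝ)).restrict (Set.Icc 0 1) =
      Measure.pi fun _ => volume.restrict (Set.Icc (0 : ℝ) 1) := by
  rw [volume_pi, ← Set.pi_univ_Icc, Measure.restrict_pi_pi]
  rfl

/-- Padding with factors 1 gives a product over all coordinates, so that Fubini factorizes the
integral. -/
lemma basisFn_eq_prod (p : ParamIndex d) (u : Fin d → ℝ) :
    basisFn p u = ∏ m, if m ∈ p.2.1 then phi p.1 (u m) else 1 := by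
  rw [basisFn, Finset.prod_ite_mem, Finset.univ_inter]

lemma integral_basisFn (p : ParamIndex d) :
    ∫ u in Set.Icc (0 : Fin d → ℝ) 1, basisFn p u = 0 := by
  simp only [basisFn_eq_prod]
  rw [volume_restrict_Icc_eq_pi,
    integral_fintype_prod_eq_prod (f := fun m x => if m ∈ p.2.1 then phi p.1 x else 1)]
  obtain ⟨m, hm⟩ : p.2.1.Nonempty := Finset.card_pos.1 (by have := p.2.2; omega)
  exact Finset.prod_eq_zero (Finset.mem_univ m) (by simp [hm, integral_phi])

lemma integral_basisFn_mul_basisFn (p q : ParamIndex d) :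
    ∫ u in Set.Icc (0 : Fin d → ℝ) 1, basisFn p u * basisFn q u = if p = q then 1 else 0 := by
  simp only [basisFn_eq_prod, ← Finset.prod_mul_distrib]
  rw [volume_restrict_Icc_eq_pi,
    integral_fintype_prod_eq_prod (f := fun m x =>
      (if m ∈ p.2.1 then phi p.1 x else 1) * (if m ∈ q.2.1 then phi q.1 x else 1))]
  split_ifs with h
  · subst h
    refine Finset.prod_eq_one fun m _ => ?_
    by_cases hm : m ∈ p.2.1 <;> simp [hm, integral_phi_mul_phi]
  -- Same set, different degrees: any coordinate of the set contributes ∫ φ₁φ₂ = 0. Different sets: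
  -- a coordinate in exactly one of them contributes ∫ φ = 0.
  · by_cases hM : p.2.1 = q.2.1
    · have hk : p.1 ≠ q.1 := fun hk => h (Prod.ext hk (Subtype.ext hM))
      obtain ⟨m, hm⟩ : p.2.1.Nonempty := Finset.card_pos.1 (by have := p.2.2; omega)
      refine Finset.prod_eq_zero (Finset.mem_univ m) ?_
      simp [hm, hM ▸ hm, integral_phi_mul_phi, hk]
    · obtain ⟨m, hm⟩ : ∃ m, ¬ (m ∈ p.2.1 ↔ m ∈ q.2.1) := by
        by_contra! hc
        exact hM (Finset.ext hc)
      refine Finset.prod_eq_zero (Finset.mem_univ m) ?_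
      by_cases hp : m ∈ p.2.1 <;> by_cases hq : m ∈ q.2.1
      · exact absurd (by simp [hp, hq]) hm
      · simp [hp, hq, integral_phi]
      · simp [hp, hq, integral_phi]
      · exact absurd (by simp [hp, hq]) hm

/-- Admissibility ensures that `ENNReal.ofReal` truncates nothing on the cube. -/
lemma integral_copula {lam : EuclideanSpace ℝ (ParamIndex d)} (hlam : IsAdmissible lam)
    (f : (Fin d → ℝ) → ℝ) :
    ∫ u, f u ∂(copula lam) = ∫ u in Set.Icc (0 : Fin d → ℝ) 1, density lam u * f u := by
  rw [copula, integral_withDensity_eq_integral_toReal_smul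
    (continuous_density lam).measurable.ennreal_ofReal (by simp)]
  refine setIntegral_congr_fun measurableSet_Icc fun u hu => ?_
  simp [ENNReal.toReal_ofReal (hlam u hu)]

/-- The coefficients of the density are its moments against the orthonormal system. -/
lemma integral_basisFn_copula {lam : EuclideanSpace ℝ (ParamIndex d)} (hlam : IsAdmissible lam)
    (p : ParamIndex d) : ∫ u, basisFn p u ∂(copula lam) = lam p := by
  have hint : ∀ f : (Fin d → ℝ) → ℝ, Continuous f →
      Integrable f (volume.restrict (Set.Icc (0 : Fin d → ℝ) 1)) := fun f hf =>
    hf.continuousOn.integrableOn_compact isCompact_Icc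
  have hc := continuous_basisFn (d := d)
  simp only [integral_copula hlam, density, add_mul, one_mul, Finset.sum_mul, mul_assoc]
  rw [integral_add (hint _ (hc p)) (hint _ (by fun_prop)), integral_basisFn,
    integral_finsetSum _ fun q _ => hint _ (by fun_prop)]
  simp [integral_const_mul, integral_basisFn_mul_basisFn]

/-- The copula is carried by a compact cube, where a continuous function is bounded. -/
lemma memLp_copula_of_continuous (lam : EuclideanSpace ℝ (ParamIndex d))
    [IsFiniteMeasure (copula lam)] {E : Type*} [NormedAddCommGroup E] [SecondCountableTopology E]
    {f : (Fin d → ℝ) → E} (hf : Continuous f) (r : ENNReal) : MemLp f r (copula lam) := by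
  borelize E
  obtain ⟨C, hC⟩ := (isCompact_Icc (a := (0 : Fin d → ℝ)) (b := 1)).exists_bound_of_continuousOn
    hf.continuousOn
  refine MemLp.of_bound hf.measurable.stronglyMeasurable.aestronglyMeasurable C ?_
  exact (withDensity_absolutelyContinuous _ _).ae_le
    ((ae_restrict_iff' measurableSet_Icc).2 (Eventually.of_forall hC))

end Orthonormality

/-! ### The estimator as a sample mean. -/

section Estimator

variable {d : ℕ} {Ω : Type*} {lam : EuclideanSpace ℝ (ParamIndex d)}

/-- The random vector of all `∏_{m ∈ M} φ_k(u_m)`, whose sample mean is the estimator. -/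
noncomputable def basisVec (u : Fin d → ℝ) : EuclideanSpace ℝ (ParamIndex d) :=
  WithLp.toLp 2 fun p => basisFn p u

lemma continuous_basisVec : Continuous (basisVec (d := d)) :=
  (PiLp.continuous_toLp 2 _).comp (continuous_pi continuous_basisFn)

lemma estimator_eq (U : ℕ → Ω → Fin d → ℝ) (n : ℕ) (ω : Ω) :
    estimator U n ω = (n : ℝ)⁻¹ • ∑ i ∈ Finset.range n, basisVec (U i ω) := by
  ext p
  simp [estimator, basisVec]

lemma sqrt_smul_estimator_sub (U : ℕ → Ω → Fin d → ℝ) (n : ℕ) (ω : Ω) :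
    √(n : ℝ) • (estimator U n ω - lam) =
      (√(n : ℝ))⁻¹ • (∑ i ∈ Finset.range n, basisVec (U i ω) - (n : ℝ) • lam) := by
  -- At `n = 0` both scalar factors are 0, since `0⁻¹ = 0`.
  rcases Nat.eq_zero_or_pos n with rfl | hn
  · simp
  have hn' : (0 : ℝ) < n := Nat.cast_pos.2 hn
  have hs : √(n : ℝ) * (n : ℝ)⁻¹ = (√(n : ℝ))⁻¹ := by
    rw [← div_eq_mul_inv, Real.sqrt_div_self]
  have hs' : (√(n : ℝ))⁻¹ * n = √(n : ℝ) := by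
    rw [← hs, mul_assoc, inv_mul_cancel₀ hn'.ne', mul_one]
  rw [estimator_eq, smul_sub, smul_sub, smul_smul, smul_smul, hs, hs']

/-- Total mass 1 is inherited from `μ` through the law of `V`, without integrating the density. -/
lemma isProbabilityMeasure_copula [MeasurableSpace Ω] {μ : Measure Ω}
    [IsProbabilityMeasure μ] {V : Ω → Fin d → ℝ}
    (hV : HasLaw V (copula lam) μ) : IsProbabilityMeasure (copula lam) :=
  hV.isProbabilityMeasure_iff.1 inferInstance

lemma asympCov_eq_covariance [IsProbabilityMeasure (copula lam)] (hlam : IsAdmissible lam) :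
    asympCov lam = Matrix.of fun p q => cov[basisFn p, basisFn q; copula lam] := by
  ext p q
  rw [Matrix.of_apply, covariance_eq_sub (memLp_copula_of_continuous lam (continuous_basisFn p) 2)
    (memLp_copula_of_continuous lam (continuous_basisFn q) 2), integral_basisFn_copula hlam,
    integral_basisFn_copula hlam]
  rfl

lemma integral_basisVec_copula [IsProbabilityMeasure (copula lam)] (hlam : IsAdmissible lam) :
    ∫ u, basisVec u ∂(copula lam) = lam := by
  ext p
  refine (ContinuousLinearMap.integral_comp_comm (EuclideanSpace.proj (𝕜 := ℝ) p)
    ((memLp_copula_of_continuous lam continuous_basisVec 1).integrable le_rfl)).symm.trans ?_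
  exact integral_basisFn_copula hlam p

end Estimator

end ExtendedFGM

theorem theorem1 {d : ℕ} (lam : EuclideanSpace ℝ (ExtendedFGM.ParamIndex d))
    (hlam : ExtendedFGM.IsAdmissible lam)
    {Ω : Type*} [MeasurableSpace Ω] (μ : Measure Ω) [IsProbabilityMeasure μ]
    (U : ℕ → Ω → Fin d → ℝ)
    (hindep : iIndepFun U μ)
    (hlaw : ∀ i, HasLaw (U i) (ExtendedFGM.copula lam) μ) :
    -- unbiasedness of every entry of the estimator
    (∀ (p : ExtendedFGM.ParamIndex d) (n : ℕ), 1 ≤ n →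
      Integrable (fun ω => ExtendedFGM.estimator U n ω p) μ ∧
        ∫ ω, ExtendedFGM.estimator U n ω p ∂μ = lam p) ∧
    -- consistency of every entry of the estimator
    (∀ p : ExtendedFGM.ParamIndex d,
      TendstoInMeasure μ (fun n ω => ExtendedFGM.estimator U n ω p) atTop (fun _ => lam p)) ∧
    -- joint asymptotic normality; the limit is a genuine Gaussian law with covariance `Σ`
    (ExtendedFGM.asympCov lam).PosSemidef ∧
    TendstoInDistribution
      (fun (n : ℕ) ω => √(n : ℝ) • (ExtendedFGM.estimator U n ω - lam))
      atTop id (fun _ => μ) (multivariateGaussian 0 (ExtendedFGM.asympCov lam)) := by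
  have := ExtendedFGM.isProbabilityMeasure_copula (hlaw 0)
  have hmB (p) := (ExtendedFGM.continuous_basisFn (d := d) p).measurable
  have hmV := (ExtendedFGM.continuous_basisVec (d := d)).measurable
  have hident : ∀ i, IdentDistrib (U i) (U 0) μ μ := fun i =>
    ⟨(hlaw i).aemeasurable, (hlaw 0).aemeasurable, (hlaw i).map_eq.trans (hlaw 0).map_eq.symm⟩
  have hmean : ∀ p i, ∫ ω, ExtendedFGM.basisFn p (U i ω) ∂μ = lam p := fun p i =>
    ((hlaw i).integral_comp (hmB p).aestronglyMeasurable).trans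
      (ExtendedFGM.integral_basisFn_copula hlam p)
  have hint : ∀ p i, Integrable (fun ω => ExtendedFGM.basisFn p (U i ω)) μ := fun p i => by
    have h := ExtendedFGM.memLp_copula_of_continuous lam (ExtendedFGM.continuous_basisFn p) 1
    rw [← (hlaw i).map_eq] at h
    exact (h.comp_of_map (hlaw i).aemeasurable).integrable le_rfl
  have hV2 : MemLp (fun ω => ExtendedFGM.basisVec (U 0 ω)) 2 μ := by
    have h := ExtendedFGM.memLp_copula_of_continuous lam ExtendedFGM.continuous_basisVec 2
    rw [← (hlaw 0).map_eq] at h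
    exact h.comp_of_map (hlaw 0).aemeasurable
  have hVmean : ∫ ω, ExtendedFGM.basisVec (U 0 ω) ∂μ = lam :=
    ((hlaw 0).integral_comp hmV.aestronglyMeasurable).trans
      (ExtendedFGM.integral_basisVec_copula hlam)
  have hcov : ExtendedFGM.asympCov lam = Matrix.of fun p q =>
      cov[fun ω => ExtendedFGM.basisVec (U 0 ω) p, fun ω => ExtendedFGM.basisVec (U 0 ω) q; μ] := by
    rw [ExtendedFGM.asympCov_eq_covariance hlam]
    ext p q
    exact ((hlaw 0).covariance_fun_comp (hmB p).aemeasurable (hmB q).aemeasurable).symm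
  refine ⟨fun p n hn => ⟨?_, ?_⟩, fun p => ?_, ?_, ?_⟩
  · exact (integrable_finsetSum _ fun i _ => hint p i).const_mul _
  -- Here `1 ≤ n` matters: the estimator is 0 at `n = 0`.
  · have hn' : (n : ℝ) ≠ 0 := Nat.cast_ne_zero.2 (by omega)
    simp only [ExtendedFGM.estimator]
    rw [integral_const_mul, integral_finsetSum _ fun i _ => hint p i]
    simp [hmean, hn']
  -- Almost sure convergence, from the strong law, implies convergence in probability.
  · refine tendstoInMeasure_of_tendsto_ae (fun n =>
      ((integrable_finsetSum _ fun i _ => hint p i).const_mul _).aestronglyMeasurable) ?_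
    have hslln := strong_law_ae_real (fun i ω => ExtendedFGM.basisFn p (U i ω)) (hint p 0)
      (fun i j hij => (hindep.indepFun hij).comp (hmB p) (hmB p))
      fun i => (hident i).comp (hmB p)
    filter_upwards [hslln] with ω hω
    rw [hmean] at hω
    simpa [ExtendedFGM.estimator, div_eq_inv_mul] using hω
  · rw [ExtendedFGM.asympCov_eq_covariance hlam]
    exact ExtendedFGM.posSemidef_covariance fun p =>
      ExtendedFGM.memLp_copula_of_continuous lam (ExtendedFGM.continuous_basisFn p) 2
  · have hclt := ExtendedFGM.tendstoInDistribution_multivariate hV2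
      (hindep.comp (fun _ => ExtendedFGM.basisVec) fun _ => hmV) fun i => (hident i).comp hmV
    simp only [Function.comp_apply, hVmean] at hclt
    simp only [ExtendedFGM.sqrt_smul_estimator_sub, hcov]
    exact hclt
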